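/- Let $m\ge 0$ and let $\mathcal G=([m],E)$ be an undirected graph (without loops or multiple edges) on $[m]=\{1,\dots,m\}$. Let $\mathcal S^+_{\mathcal G}$ be the cone of positive definite symmetric matrices $K\in\mathbb R^{m\times m}$ with $K_{ij}=0$ whenever $i\ne j$ and $\{i,j\}\notin E$. Let $\mathrm{GL}_m(\mathbb R)$ act on symmetric matrices by $g\cdot K=g^{-T}Kg^{-1}$, and let $$G=\{g\in \mathrm{GL}_m(\mathbb R)\mid g\cdot \mathcal S^+_{\mathcal G}\subseteq \mathcal S^+_{\mathcal G}\},$$ which is a Zariski-closed subgroup of $\mathrm{GL}_m(\mathbb R)$; let $\mathfrak g=\{X\in\mathbb R^{m\times m}\mid \exp(tX)\in G\text{ for all }t\in\mathbb R\}$ be its Lie algebra. Write $N(i)$ for the set of neighbours of $i$ in $\mathcal G$, and define a pre-order on $[m]$ by $i\preccurlyeq j$ if and only if $N(j)\cup\{j\}\subseteq N(i)\cup\{i\}$. Let $E_{ij}$ be the $m\times m$ matrix with a one at position $(i,j)$ and zeroes elsewhere. Then for all $i,j\in[m]$, the matrix $E_{ij}$ lies in $\mathfrak g$ if and only if $j\preccurlyeq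 i$. Consequently, the identity component of $G$, that is, the connected component of $G$ containing the identity in the Zariski topology (whose closed sets are the zero sets in $\mathrm{GL}_m(\mathbb R)$ of real polynomials in the matrix entries), is exactly the group $$G^0=\{g\in \mathrm{GL}_m(\mathbb R)\mid g_{ij}=0\text{ for all } i,j \text{ with } j\not\preccurlyeq i\}.$$ -/

import Mathlib

open Matrix

namespace GaussianGraph

variable {m : ℕ}

/-- The cone `S⁺_𝒢` of positive definite real symmetric matrices whose `(i, j)` off-diagonal entry
vanishes whenever `{i, j}` is not an edge of `𝒢`. (For real matrices `Matrix.PosDef` includes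
symmetry.) -/
def concentrationCone (𝒢 : SimpleGraph (Fin m)) : Set (Matrix (Fin m) (Fin m) ℝ) :=
  {K | K.PosDef ∧ ∀ i j, i ≠ j → ¬ 𝒢.Adj i j → K i j = 0}

/-- The linear action `g · K = g⁻ᵀ K g⁻¹` of `GL_m(ℝ)` on `m × m` matrices. -/
def act (g : GL (Fin m) ℝ) :
    Matrix (Fin m) (Fin m) ℝ →ₗ[ℝ] Matrix (Fin m) (Fin m) ℝ where
  toFun K := (↑(g⁻¹) : Matrix (Fin m) (Fin m) ℝ)ᵀ * K * (↑(g⁻¹) : Matrix (Fin m) (Fin m) ℝ)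
  map_add' K L := by rw [mul_add, add_mul]
  map_smul' c K := by simp

theorem act_one (K : Matrix (Fin m) (Fin m) ℝ) : act 1 K = K := by simp [act]

theorem act_mul (g h : GL (Fin m) ℝ) (K : Matrix (Fin m) (Fin m) ℝ) :
    act (g * h) K = act g (act h K) := by
  simp only [act, LinearMap.coe_mk, AddHom.coe_mk, _root_.mul_inv_rev, Units.val_mul,
    Matrix.transpose_mul, Matrix.mul_assoc]

theorem act_posDef (g : GL (Fin m) ℝ) {K : Matrix (Fin m) (Fin m) ℝ} (hK : K.PosDef) :
    (act g K).PosDef := by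
  have h := hK.conjTranspose_mul_mul_same (B := (↑(g⁻¹) : Matrix (Fin m) (Fin m) ℝ))
    (Matrix.mulVec_injective_of_isUnit (Units.isUnit _))
  simpa [act, Matrix.conjTranspose_eq_transpose_of_trivial] using h

theorem act_inv_mem (𝒢 : SimpleGraph (Fin m)) (g : GL (Fin m) ℝ)
    (hg : ∀ K ∈ concentrationCone 𝒢, act g K ∈ concentrationCone 𝒢)
    {K : Matrix (Fin m) (Fin m) ℝ} (hK : K ∈ concentrationCone 𝒢) :
    act g⁻¹ K ∈ concentrationCone 𝒢 := by
  have hzero : ∀ L ∈ Submodule.span ℝ (concentrationCone 𝒢),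
      ∀ i j, i ≠ j → ¬ 𝒢.Adj i j → L i j = 0 := by
    intro L hL i j hij hadj
    induction hL using Submodule.span_induction with
    | mem x hx => exact hx.2 i j hij hadj
    | zero => rfl
    | add x y _ _ hx hy => simp [hx, hy]
    | smul a x _ hx => simp [hx]
  have hmap : ∀ L ∈ Submodule.span ℝ (concentrationCone 𝒢),
      act g L ∈ Submodule.span ℝ (concentrationCone 𝒢) := by
    intro L hL
    induction hL using Submodule.span_induction with
    | mem x hx => exact Submodule.subset_span (hg x hx)
    | zero => simp
    | add x y _ _ hx hy => rw [map_add]; exact add_mem hx hy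
    | smul a x _ hx => rw [map_smul]; exact Submodule.smul_mem _ _ hx
  have hcancel : ∀ L, act g⁻¹ (act g L) = L := fun L => by
    rw [← act_mul, inv_mul_cancel, act_one]
  have hinj : Function.Injective ((act g).restrict hmap) := by
    intro a b hab
    have h1 : act g a = act g b := congrArg Subtype.val hab
    apply Subtype.ext
    rw [← hcancel a, h1, hcancel]
  obtain ⟨L, hL⟩ := LinearMap.surjective_of_injective hinj ⟨K, Submodule.subset_span hK⟩
  have hL' : act g L = K := congrArg Subtype.val hL
  refine ⟨act_posDef _ hK.1, ?_⟩
  rw [← hL', hcancel]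
  exact hzero L L.2

/-- The group `G = {g ∈ GL_m(ℝ) | g · S⁺_𝒢 ⊆ S⁺_𝒢}`. -/
def stabilizerGroup (𝒢 : SimpleGraph (Fin m)) : Subgroup (GL (Fin m) ℝ) where
  carrier := {g | ∀ K ∈ concentrationCone 𝒢, act g K ∈ concentrationCone 𝒢}
  mul_mem' {g h} hg hh K hK := by
    rw [act_mul]
    exact hg _ (hh K hK)
  one_mem' K hK := by rwa [act_one]
  inv_mem' {g} hg _ hK := act_inv_mem 𝒢 g hg hK

/-- The pre-order on the vertices: `i ≼ j` iff `N(j) ∪ {j} ⊆ N(i) ∪ {i}`. -/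
def VertexLE (𝒢 : SimpleGraph (Fin m)) (i j : Fin m) : Prop :=
  𝒢.neighborSet j ∪ {j} ⊆ 𝒢.neighborSet i ∪ {i}

theorem pattern_mul (𝒢 : SimpleGraph (Fin m)) {A B : Matrix (Fin m) (Fin m) ℝ}
    (hA : ∀ i j, ¬ VertexLE 𝒢 j i → A i j = 0) (hB : ∀ i j, ¬ VertexLE 𝒢 j i → B i j = 0) :
    ∀ i j, ¬ VertexLE 𝒢 j i → (A * B) i j = 0 := by
  intro i k hik
  rw [Matrix.mul_apply]
  refine Finset.sum_eq_zero fun j _ => ?_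
  by_cases h1 : VertexLE 𝒢 j i
  · by_cases h2 : VertexLE 𝒢 k j
    · exact absurd (Set.Subset.trans h1 h2) hik
    · rw [hB j k h2, mul_zero]
  · rw [hA i j h1, zero_mul]

theorem pattern_one (𝒢 : SimpleGraph (Fin m)) :
    ∀ i j, ¬ VertexLE 𝒢 j i → (1 : Matrix (Fin m) (Fin m) ℝ) i j = 0 := by
  intro i j h
  refine Matrix.one_apply_ne fun hij => h ?_
  subst hij
  exact Set.Subset.refl _

theorem pattern_inv (𝒢 : SimpleGraph (Fin m)) (g : GL (Fin m) ℝ)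
    (hg : ∀ i j, ¬ VertexLE 𝒢 j i → g i j = 0) :
    ∀ i j, ¬ VertexLE 𝒢 j i → g⁻¹ i j = 0 := by
  let P : Submodule ℝ (Matrix (Fin m) (Fin m) ℝ) :=
    { carrier := {A | ∀ i j, ¬ VertexLE 𝒢 j i → A i j = 0}
      add_mem' := fun {A B} hA hB i j h => by simp [hA i j h, hB i j h]
      zero_mem' := fun _ _ _ => rfl
      smul_mem' := fun c A hA i j h => by simp [hA i j h] }
  have hmap : ∀ A ∈ P, LinearMap.mulLeft ℝ (g : Matrix (Fin m) (Fin m) ℝ) A ∈ P :=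
    fun A hA => pattern_mul 𝒢 hg hA
  have hinj : Function.Injective
      ((LinearMap.mulLeft ℝ (g : Matrix (Fin m) (Fin m) ℝ)).restrict hmap) := by
    intro a b hab
    have h1 : (g : Matrix (Fin m) (Fin m) ℝ) * a = g * b := congrArg Subtype.val hab
    exact Subtype.ext ((Units.mul_right_inj g).1 h1)
  obtain ⟨A, hA⟩ := LinearMap.surjective_of_injective hinj ⟨1, pattern_one 𝒢⟩
  have hA' : (g : Matrix (Fin m) (Fin m) ℝ) * A = 1 := congrArg Subtype.val hA
  have hval : (↑(g⁻¹) : Matrix (Fin m) (Fin m) ℝ) = A := Units.inv_eq_of_mul_eq_one_right hA'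
  intro i j h
  rw [hval]
  exact A.2 i j h

/-- The pattern group `G⁰ = {g ∈ GL_m(ℝ) | g_ij = 0 for all i, j with j ⋠ i}`. -/
def patternGroup (𝒢 : SimpleGraph (Fin m)) : Subgroup (GL (Fin m) ℝ) where
  carrier := {g | ∀ i j, ¬ VertexLE 𝒢 j i → g i j = 0}
  mul_mem' {g h} hg hh := by
    intro i j hij
    rw [Units.val_mul]
    exact pattern_mul 𝒢 hg hh i j hij
  one_mem' := pattern_one 𝒢
  inv_mem' {g} hg := pattern_inv 𝒢 g hg

/-- The Lie algebra (as a set of real matrices) of a closed subgroup `H` of `GL_m(ℝ)`: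
all `X` whose one-parameter group `exp (t X)`, `t ∈ ℝ`, lies in `H`. -/
def lieAlgebra (H : Subgroup (GL (Fin m) ℝ)) : Set (Matrix (Fin m) (Fin m) ℝ) :=
  {X | ∀ t : ℝ, ∃ h ∈ H, (h : Matrix (Fin m) (Fin m) ℝ) = NormedSpace.exp (t • X)}

/-- The common zero set in `GL_m(ℝ)` of a set of real polynomials in the matrix entries. -/
def zeroLocus (S : Set (MvPolynomial (Fin m × Fin m) ℝ)) : Set (GL (Fin m) ℝ) :=
  {g | ∀ f ∈ S, MvPolynomial.eval (fun p => g p.1 p.2) f = 0}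

/-- The Zariski topology on `GL_m(ℝ)`: the closed sets are the zero sets of polynomials in the
matrix entries. It is not an instance, so that it does not compete with the Euclidean topology. -/
@[reducible] def zariskiTopology (m : ℕ) : TopologicalSpace (GL (Fin m) ℝ) :=
  TopologicalSpace.ofClosed (Set.range (zeroLocus (m := m)))
    ⟨{1}, by ext g; simp [zeroLocus]⟩
    (by
      intro A hA
      refine ⟨{f | ∃ S, zeroLocus S ∈ A ∧ f ∈ S}, ?_⟩
      ext g
      constructor
      · intro h Z hZ
        obtain ⟨S, rfl⟩ := hA hZ
        exact fun f hf => h f ⟨S, hZ, hf⟩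
      · rintro h f ⟨S, hS, hf⟩
        exact h _ hS f hf)
    (by
      rintro _ ⟨S, rfl⟩ _ ⟨T, rfl⟩
      refine ⟨{f | ∃ a ∈ S, ∃ b ∈ T, f = a * b}, ?_⟩
      ext g
      constructor
      · intro h
        by_contra hn
        simp only [zeroLocus, Set.mem_union, Set.mem_ofPred_eq, not_or, not_forall] at hn
        obtain ⟨⟨a, ha, ha'⟩, b, hb, hb'⟩ := hn
        have := h (a * b) ⟨a, ha, b, hb, rfl⟩
        rw [map_mul] at this
        exact (mul_ne_zero ha' hb') this
      · rintro (h | h) f ⟨a, ha, b, hb, rfl⟩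
        · rw [map_mul, h a ha, zero_mul]
        · rw [map_mul, h b hb, mul_zero])

/-- The Zariski identity component of a subgroup `H` of `GL_m(ℝ)`: the connected component of the
identity in `H`, for the subspace topology of the Zariski topology. -/
def zariskiIdentityComponent (H : Subgroup (GL (Fin m) ℝ)) : Set (GL (Fin m) ℝ) :=
  @connectedComponentIn _ (zariskiTopology m) (H : Set (GL (Fin m) ℝ)) 1

end GaussianGraph

namespace GaussianGraph

variable {m : ℕ}

/-! Applying `g ∈ G` to `1` and to `1 + v vᵀ`, with `v` supported on a vertex or an edge, shows that
rows of `g` at equal or adjacent vertices have supports forming a clique (`adj_of_apply_ne_zero`). A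
nonzero term of `det g` gives a permutation `σ`, which is then a graph automorphism and places `g`
in the pattern permuted by `σ`. So `G` is covered by finitely many Zariski-closed permuted patterns.
Those meeting the pattern group lie inside it, so the pattern group is open and closed in `G`; it is
connected because lines through `1` are. Row supports also decide the Lie algebra, since `exp E_ij =
1 + E_ij` for `i ≠ j`. -/

/-! ### The pre-order on vertices -/

theorem VertexLE.refl (𝒢 : SimpleGraph (Fin m)) (i : Fin m) : VertexLE 𝒢 i i :=
  Set.Subset.refl _

theorem VertexLE.trans {𝒢 : SimpleGraph (Fin m)} {i j k : Fin m} (hij : VertexLE 𝒢 i j)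
    (hjk : VertexLE 𝒢 j k) : VertexLE 𝒢 i k :=
  Set.Subset.trans hjk hij

theorem vertexLE_iff {𝒢 : SimpleGraph (Fin m)} {i j : Fin m} :
    VertexLE 𝒢 i j ↔ ∀ k, (k = j ∨ 𝒢.Adj j k) → (k = i ∨ 𝒢.Adj i k) := by
  simp only [VertexLE, Set.subset_def, Set.mem_union, Set.mem_singleton_iff,
    SimpleGraph.mem_neighborSet]
  exact forall_congr' fun k => by rw [or_comm, or_comm (a := 𝒢.Adj i k)]

/-- If a permutation sends every vertex below itself, it also sends every vertex above itself. -/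
theorem vertexLE_perm_apply {𝒢 : SimpleGraph (Fin m)} {τ : Equiv.Perm (Fin m)}
    (h : ∀ k, VertexLE 𝒢 (τ k) k) (k : Fin m) : VertexLE 𝒢 k (τ k) := by
  have hpow : ∀ (n : ℕ) (l : Fin m), VertexLE 𝒢 ((τ ^ n) l) l := by
    intro n
    induction n with
    | zero => exact fun l => VertexLE.refl 𝒢 l
    | succ n ih =>
      intro l
      rw [pow_succ, Equiv.Perm.mul_apply]
      exact (ih _).trans (h l)
  -- This power of `τ` is `τ⁻¹`, by finiteness.
  have hk := hpow (orderOf τ - 1) (τ k)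
  rwa [← Equiv.Perm.mul_apply, ← pow_succ, Nat.sub_add_cancel (orderOf_pos τ), pow_orderOf_eq_one,
    Equiv.Perm.one_apply] at hk

/-! ### Row supports of stabilizing matrices -/

theorem one_mem_concentrationCone (𝒢 : SimpleGraph (Fin m)) : 1 ∈ concentrationCone 𝒢 :=
  ⟨Matrix.PosDef.one, fun _ _ h _ => Matrix.one_apply_ne h⟩

theorem one_add_vecMulVec_mem_concentrationCone {𝒢 : SimpleGraph (Fin m)} {v : Fin m → ℝ}
    (hv : ∀ i j, i ≠ j → ¬ 𝒢.Adj i j → v i * v j = 0) :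
    1 + vecMulVec v v ∈ concentrationCone 𝒢 := by
  refine ⟨Matrix.PosDef.one.add_posSemidef ?_, fun i j hij hadj => ?_⟩
  · simpa using posSemidef_vecMulVec_self_star v
  · simp [Matrix.one_apply_ne hij, vecMulVec_apply, hv i j hij hadj]

theorem transpose_mul_mul_mem {𝒢 : SimpleGraph (Fin m)} {g : GL (Fin m) ℝ}
    (hg : g ∈ stabilizerGroup 𝒢) {K : Matrix (Fin m) (Fin m) ℝ} (hK : K ∈ concentrationCone 𝒢) :
    (g : Matrix (Fin m) (Fin m) ℝ)ᵀ * K * g ∈ concentrationCone 𝒢 := by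
  simpa [act] using inv_mem hg K hK

/-- Subtracting the image of `1` from that of `1 + v vᵀ` leaves the rank-one matrix `(gᵀ v)(gᵀ v)ᵀ`,
whose forbidden entries must vanish. -/
theorem vecMul_mul_vecMul_eq_zero {𝒢 : SimpleGraph (Fin m)} {g : GL (Fin m) ℝ}
    (hg : g ∈ stabilizerGroup 𝒢) {v : Fin m → ℝ}
    (hv : ∀ i j, i ≠ j → ¬ 𝒢.Adj i j → v i * v j = 0) {i j : Fin m} (hij : i ≠ j)
    (hadj : ¬ 𝒢.Adj i j) :
    (v ᵥ* (g : Matrix (Fin m) (Fin m) ℝ)) i * (v ᵥ* (g : Matrix (Fin m) (Fin m) ℝ)) j = 0 := by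
  have h1 := (transpose_mul_mul_mem hg (one_mem_concentrationCone 𝒢)).2 i j hij hadj
  have h2 := (transpose_mul_mul_mem hg
    (one_add_vecMulVec_mem_concentrationCone hv)).2 i j hij hadj
  rwa [mul_add, add_mul, Matrix.add_apply, h1, zero_add, mul_vecMulVec, vecMulVec_mul,
    mulVec_transpose, vecMulVec_apply] at h2

/-- The supports of the rows of `g` indexed by two equal or adjacent vertices form a clique. -/
theorem adj_of_apply_ne_zero {𝒢 : SimpleGraph (Fin m)} {g : GL (Fin m) ℝ}
    (hg : g ∈ stabilizerGroup 𝒢) {k l i j : Fin m} (hkl : l = k ∨ 𝒢.Adj k l) (hij : i ≠ j)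
    (hi : g k i ≠ 0) (hj : g l j ≠ 0) : 𝒢.Adj i j := by
  by_contra hadj
  have key : ∀ a b : ℝ, (a * g k i + b * g l i) * (a * g k j + b * g l j) = 0 := by
    intro a b
    have hv : ∀ p q, p ≠ q → ¬ 𝒢.Adj p q →
        (Pi.single k a + Pi.single l b : Fin m → ℝ) p *
          (Pi.single k a + Pi.single l b : Fin m → ℝ) q = 0 := by
      intro p q hpq hnadj
      rcases hkl with rfl | hkl
      · rw [← Pi.single_add]
        by_cases hp : p = l
        · rw [Pi.single_eq_of_ne (i := l) (i' := q) (fun h => hpq (hp.trans h.symm)), mul_zero]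
        · rw [Pi.single_eq_of_ne hp, zero_mul]
      · have := hkl.symm
        simp only [Pi.add_apply, Pi.single_apply]
        split_ifs <;> simp_all
    simpa [Matrix.add_vecMul, Matrix.single_vecMul] using vecMul_mul_vecMul_eq_zero hg hv hij hadj
  -- Single rows kill `g k j` and `g l i`; the sum of the rows then leaves `g k i * g l j = 0`.
  have h1 : g k j = 0 := by simpa [hi] using key 1 0
  have h2 : g l i = 0 := by simpa [hj] using key 0 1
  simpa [h1, h2, hi, hj] using key 1 1

/-! ### Permuted patterns -/

theorem exists_perm_apply_ne_zero (g : GL (Fin m) ℝ) :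
    ∃ σ : Equiv.Perm (Fin m), ∀ k, g k (σ k) ≠ 0 := by
  by_contra! h
  refine (g.isUnit.map Matrix.detMonoidHom).ne_zero ?_
  change (g : Matrix (Fin m) (Fin m) ℝ).det = 0
  rw [← Matrix.det_transpose, Matrix.det_apply]
  refine Finset.sum_eq_zero fun σ _ => ?_
  obtain ⟨k, hk⟩ := h σ
  rw [Finset.prod_eq_zero (Finset.mem_univ k) (by simpa using hk), smul_zero]

/-- A permutation of the vertices of a finite graph that preserves adjacency reflects it. -/
theorem adj_of_perm_adj {𝒢 : SimpleGraph (Fin m)} {σ : Equiv.Perm (Fin m)}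
    (h : ∀ k l, 𝒢.Adj k l → 𝒢.Adj (σ k) (σ l)) {k l : Fin m} (hkl : 𝒢.Adj (σ k) (σ l)) :
    𝒢.Adj k l := by
  have hpow : ∀ (n : ℕ) (k l : Fin m), 𝒢.Adj k l → 𝒢.Adj ((σ ^ n) k) ((σ ^ n) l) := by
    intro n
    induction n with
    | zero => exact fun _ _ => id
    | succ n ih =>
      intro k l hkl
      rw [pow_succ, Equiv.Perm.mul_apply, Equiv.Perm.mul_apply]
      exact ih _ _ (h k l hkl)
  have := hpow (orderOf σ - 1) _ _ hkl
  rwa [← Equiv.Perm.mul_apply, ← Equiv.Perm.mul_apply, ← pow_succ,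
    Nat.sub_add_cancel (orderOf_pos σ), pow_orderOf_eq_one, Equiv.Perm.one_apply,
    Equiv.Perm.one_apply] at this

/-- The invertible matrices that lie in the pattern after a permutation of the rows by `σ`. -/
def permutedPattern (𝒢 : SimpleGraph (Fin m)) (σ : Equiv.Perm (Fin m)) : Set (GL (Fin m) ℝ) :=
  {g | ∀ k j, ¬ VertexLE 𝒢 j (σ k) → g k j = 0}

/-- If `g k j ≠ 0` and `σ l` is in the closed neighbourhood of `σ k`, then `l` is in that of `k`,
and the nonzero entries `g k j`, `g l (σ l)` make `j` and `σ l` equal or adjacent. -/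
theorem exists_mem_permutedPattern {𝒢 : SimpleGraph (Fin m)} {g : GL (Fin m) ℝ}
    (hg : g ∈ stabilizerGroup 𝒢) : ∃ σ, g ∈ permutedPattern 𝒢 σ := by
  obtain ⟨σ, hσ⟩ := exists_perm_apply_ne_zero g
  have hmap : ∀ k l, 𝒢.Adj k l → 𝒢.Adj (σ k) (σ l) := fun k l hkl =>
    adj_of_apply_ne_zero hg (Or.inr hkl) (fun h => hkl.ne (σ.injective h)) (hσ k) (hσ l)
  refine ⟨σ, fun k j => ?_⟩
  contrapose!
  intro hkj
  rw [vertexLE_iff]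
  intro l hl
  obtain ⟨l, rfl⟩ := σ.surjective l
  by_cases h : σ l = j
  · exact Or.inl h
  · refine Or.inr (adj_of_apply_ne_zero hg ?_ (Ne.symm h) hkj (hσ l))
    exact hl.imp (fun h => σ.injective h) (adj_of_perm_adj hmap)

/-- A permuted pattern that meets the pattern group is contained in it. -/
theorem permutedPattern_subset {𝒢 : SimpleGraph (Fin m)} {σ : Equiv.Perm (Fin m)}
    {g : GL (Fin m) ℝ} (hσ : g ∈ permutedPattern 𝒢 σ) (hg : g ∈ patternGroup 𝒢) :
    permutedPattern 𝒢 σ ⊆ patternGroup 𝒢 := by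
  obtain ⟨τ, hτ⟩ := exists_perm_apply_ne_zero g
  have h1 : ∀ k, VertexLE 𝒢 (τ k) k := fun k => by_contra fun h => hτ k (hg k _ h)
  have h2 : ∀ k, VertexLE 𝒢 (τ k) (σ k) := fun k => by_contra fun h => hτ k (hσ k _ h)
  have h3 : ∀ k, VertexLE 𝒢 (σ k) (τ k) := fun k => by
    -- The permutation `τ σ⁻¹` sends every vertex below itself, hence also above.
    have := vertexLE_perm_apply (τ := σ.symm.trans τ) (𝒢 := 𝒢)
      (fun l => by simpa using h2 (σ.symm l)) (σ k)
    simpa using this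
  exact fun p hp i j hij => hp i j fun h => hij ((h.trans (h3 i)).trans (h1 i))

/-! ### Zariski topology and the identity component -/

theorem isClosed_zariski_iff {Z : Set (GL (Fin m) ℝ)} :
    @IsClosed _ (zariskiTopology m) Z ↔ ∃ S, zeroLocus S = Z := by
  let _ := zariskiTopology m
  rw [← isOpen_compl_iff]
  change Zᶜᶜ ∈ Set.range zeroLocus ↔ _
  rw [compl_compl, Set.mem_range]

theorem isClosed_permutedPattern (𝒢 : SimpleGraph (Fin m)) (σ : Equiv.Perm (Fin m)) :
    @IsClosed _ (zariskiTopology m) (permutedPattern 𝒢 σ) := by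
  refine isClosed_zariski_iff.2
    ⟨{f | ∃ k j, ¬ VertexLE 𝒢 j (σ k) ∧ f = MvPolynomial.X (k, j)}, ?_⟩
  ext g
  constructor
  · intro h k j hkj
    simpa using h _ ⟨k, j, hkj, rfl⟩
  · rintro h _ ⟨k, j, hkj, rfl⟩
    simpa using h k j hkj

/-- A nonzero term of entry `(i, j)` needs `i ≼ k`, `j ≼ l` with `k`, `l` equal or adjacent. Then `l
∈ N[k] ⊆ N[i]`, so `i ∈ N[l] ⊆ N[j]`. -/
theorem patternGroup_le_stabilizerGroup (𝒢 : SimpleGraph (Fin m)) :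
    patternGroup 𝒢 ≤ stabilizerGroup 𝒢 := by
  intro g hg K hK
  refine ⟨act_posDef g hK.1, fun i j hij hadj => ?_⟩
  have hh := inv_mem hg
  simp only [act, LinearMap.coe_mk, AddHom.coe_mk, Matrix.mul_apply, Matrix.transpose_apply,
    Finset.sum_mul]
  refine Finset.sum_eq_zero fun l _ => Finset.sum_eq_zero fun k _ => ?_
  by_cases hik : VertexLE 𝒢 i k
  · by_cases hjl : VertexLE 𝒢 j l
    · rw [hK.2 k l, mul_zero, zero_mul]
      · rintro rfl
        rcases vertexLE_iff.1 hjl k (Or.inl rfl) with rfl | h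
        · rcases vertexLE_iff.1 hik k (Or.inl rfl) with rfl | h
          · exact hij rfl
          · exact hadj h
        · rcases vertexLE_iff.1 hik j (Or.inr h.symm) with rfl | h
          · exact hij rfl
          · exact hadj h
      · intro hkl
        rcases vertexLE_iff.1 hjl k (Or.inr hkl.symm) with rfl | h
        · rcases vertexLE_iff.1 hik k (Or.inl rfl) with rfl | h
          · exact hij rfl
          · exact hadj h
        · rcases vertexLE_iff.1 hik j (Or.inr h.symm) with rfl | h
          · exact hij rfl
          · exact hadj h
    · rw [hh l j hjl, mul_zero]
  · rw [hh k i hik, zero_mul, zero_mul]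

/-- The affine line through `1` and `g`, as a matrix over `ℝ[X]`. -/
noncomputable def linePolynomial (g : Matrix (Fin m) (Fin m) ℝ) :
    Matrix (Fin m) (Fin m) (Polynomial ℝ) :=
  fun i j => Polynomial.C ((1 : Matrix (Fin m) (Fin m) ℝ) i j) +
    Polynomial.X * Polynomial.C ((g - 1) i j)

theorem map_eval_linePolynomial (g : Matrix (Fin m) (Fin m) ℝ) (t : ℝ) :
    (linePolynomial g).map (Polynomial.eval t) = 1 + t • (g - 1) := by
  ext i j
  simp [linePolynomial]

theorem eval_det_linePolynomial (g : Matrix (Fin m) (Fin m) ℝ) (t : ℝ) :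
    (linePolynomial g).det.eval t = (1 + t • (g - 1)).det := by
  rw [← map_eval_linePolynomial]
  exact RingHom.map_det (Polynomial.evalRingHom t) (linePolynomial g)

theorem eval_aeval_linePolynomial (g : Matrix (Fin m) (Fin m) ℝ)
    (f : MvPolynomial (Fin m × Fin m) ℝ) (t : ℝ) :
    (MvPolynomial.aeval (fun p : Fin m × Fin m => linePolynomial g p.1 p.2) f).eval t =
      MvPolynomial.eval (fun p : Fin m × Fin m => (1 + t • (g - 1)) p.1 p.2) f := by
  rw [← map_eval_linePolynomial, MvPolynomial.aeval_def, MvPolynomial.eval,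
    ← Polynomial.coe_evalRingHom, MvPolynomial.hom_eval₂]
  congr 1
  ext x
  simp

/-- The pattern group is irreducible along lines through the identity, hence connected. -/
theorem isPreconnected_patternGroup (𝒢 : SimpleGraph (Fin m)) :
    @IsPreconnected _ (zariskiTopology m) (patternGroup 𝒢 : Set (GL (Fin m) ℝ)) := by
  let _ := zariskiTopology m
  refine isPreconnected_of_forall (1 : GL (Fin m) ℝ) fun g hg => ?_
  refine ⟨{h | ∃ t : ℝ, (h : Matrix (Fin m) (Fin m) ℝ) = 1 + t • ((g : Matrix _ _ ℝ) - 1)},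
    ?_, ⟨0, by simp⟩, ⟨1, by simp⟩, ?_⟩
  · rintro h ⟨t, ht⟩ i j hij
    rw [ht]
    simp [pattern_one 𝒢 i j hij, hg i j hij]
  · rw [isPreconnected_closed_iff]
    intro A B hA hB hAB hA' hB'
    rw [isClosed_zariski_iff] at hA hB
    obtain ⟨S, rfl⟩ := hA
    obtain ⟨T, rfl⟩ := hB
    set M : Matrix (Fin m) (Fin m) ℝ := g.val
    let ev : MvPolynomial (Fin m × Fin m) ℝ → Polynomial ℝ := fun f =>
      MvPolynomial.aeval (fun p : Fin m × Fin m => linePolynomial M p.1 p.2) f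
    have hev : ∀ f t, (ev f).eval t = _ := eval_aeval_linePolynomial M
    have hdet : (linePolynomial M).det ≠ 0 := by
      intro h
      have := eval_det_linePolynomial M 0
      simp [h] at this
    have key : (∀ f ∈ S, ev f = 0) ∨ ∀ f ∈ T, ev f = 0 := by
      by_contra! hn
      obtain ⟨⟨a, ha, ha'⟩, b, hb, hb'⟩ := hn
      -- The determinant factor absorbs the values of `t` at which the line leaves `GL`.
      refine mul_ne_zero hdet (mul_ne_zero ha' hb') (Polynomial.funext fun t => ?_)
      rw [Polynomial.eval_mul, Polynomial.eval_mul, Polynomial.eval_zero,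
        eval_det_linePolynomial, hev, hev]
      by_cases hd : (1 + t • (M - 1)).det = 0
      · rw [hd, zero_mul]
      · have hu : (Matrix.GeneralLinearGroup.mkOfDetNeZero _ hd : Matrix _ _ ℝ) =
          1 + t • (M - 1) := rfl
        rcases hAB ⟨t, hu⟩ with h | h
        · have := h a ha
          rw [hu] at this
          rw [this, zero_mul, mul_zero]
        · have := h b hb
          rw [hu] at this
          rw [this, mul_zero, mul_zero]
    have hzero : ∀ U : Set (MvPolynomial (Fin m × Fin m) ℝ), (∀ f ∈ U, ev f = 0) →
        ∀ (h : GL (Fin m) ℝ) (t : ℝ), (h : Matrix _ _ ℝ) = 1 + t • (M - 1) →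
          h ∈ zeroLocus U := by
      intro U hU h t ht f hf
      rw [ht, ← hev, hU f hf, Polynomial.eval_zero]
    -- One closed set contains the whole line, so any point of the line in the other lies in both.
    rcases key with h | h
    · obtain ⟨x, ⟨t, ht⟩, hx⟩ := hB'
      exact ⟨x, ⟨t, ht⟩, hzero S h x t ht, hx⟩
    · obtain ⟨x, ⟨t, ht⟩, hx⟩ := hA'
      exact ⟨x, ⟨t, ht⟩, hx, hzero T h x t ht⟩

theorem zariskiIdentityComponent_stabilizerGroup (𝒢 : SimpleGraph (Fin m)) :
    zariskiIdentityComponent (stabilizerGroup 𝒢) = (patternGroup 𝒢 : Set (GL (Fin m) ℝ)) := by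
  let _ := zariskiTopology m
  refine Set.Subset.antisymm ?_ ?_
  · let B : Set (GL (Fin m) ℝ) := ⋃ σ ∈ {σ : Equiv.Perm (Fin m) |
      ¬ permutedPattern 𝒢 σ ⊆ patternGroup 𝒢}, permutedPattern 𝒢 σ
    have hB : IsClosed B :=
      (Set.toFinite _).isClosed_biUnion fun σ _ => isClosed_permutedPattern 𝒢 σ
    have hdisj : Disjoint (patternGroup 𝒢 : Set (GL (Fin m) ℝ)) B := by
      rw [Set.disjoint_left]
      intro g hg hgB
      obtain ⟨σ, hσ, hgσ⟩ := Set.mem_iUnion₂.1 hgB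
      exact hσ (permutedPattern_subset hgσ hg)
    have hcover : (stabilizerGroup 𝒢 : Set (GL (Fin m) ℝ)) ⊆ patternGroup 𝒢 ∪ B := by
      intro g hg
      obtain ⟨σ, hσ⟩ := exists_mem_permutedPattern hg
      by_cases h : permutedPattern 𝒢 σ ⊆ patternGroup 𝒢
      · exact Or.inl (h hσ)
      · exact Or.inr (Set.mem_iUnion₂.2 ⟨σ, h, hσ⟩)
    have hconn : IsPreconnected (zariskiIdentityComponent (stabilizerGroup 𝒢)) :=
      isPreconnected_connectedComponentIn
    -- The pattern group is the permuted pattern of the identity.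
    have hP : IsClosed (patternGroup 𝒢 : Set (GL (Fin m) ℝ)) := isClosed_permutedPattern 𝒢 1
    rcases isPreconnected_iff_subset_of_disjoint_closed.1 hconn _ _ hP hB
      ((connectedComponentIn_subset _ _).trans hcover)
      (by rw [hdisj.inter_eq, Set.inter_empty]) with h | h
    · exact h
    · exact absurd (h (mem_connectedComponentIn (one_mem (stabilizerGroup 𝒢))))
        (Set.disjoint_left.1 hdisj (one_mem (patternGroup 𝒢)))
  · exact (isPreconnected_patternGroup 𝒢).subset_connectedComponentIn (one_mem (patternGroup 𝒢))
      (patternGroup_le_stabilizerGroup 𝒢)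

/-! ### Elementary matrices in the Lie algebra -/

theorem exp_single_of_ne {i j : Fin m} (hij : i ≠ j) (t : ℝ) :
    NormedSpace.exp (t • Matrix.single i j (1 : ℝ)) = 1 + t • Matrix.single i j (1 : ℝ) := by
  have hsq : (t • Matrix.single i j (1 : ℝ)) ^ 2 = 0 := by
    simp [pow_two, Matrix.single_mul_single_of_ne _ _ _ _ hij.symm]
  rw [NormedSpace.exp_eq_tsum ℝ]
  beta_reduce
  rw [tsum_eq_sum (s := Finset.range 2)]
  · simp [Finset.sum_range_succ]
  · intro n hn
    rw [Finset.mem_range, not_lt] at hn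
    rw [pow_eq_zero_of_le hn hsq, smul_zero]

theorem exp_single_apply_eq_zero {i j k l : Fin m} (t : ℝ) (hkl : k ≠ l)
    (h : ¬ (k = i ∧ l = j)) :
    (NormedSpace.exp (t • Matrix.single i j (1 : ℝ)) : Matrix (Fin m) (Fin m) ℝ) k l = 0 := by
  by_cases hij : i = j
  · subst hij
    rw [Matrix.smul_single, ← Matrix.diagonal_single, Matrix.exp_diagonal,
      Matrix.diagonal_apply_ne _ hkl]
  · rw [exp_single_of_ne hij]
    have : ¬ (i = k ∧ j = l) := fun h' => h ⟨h'.1.symm, h'.2.symm⟩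
    simp [Matrix.one_apply_ne hkl, this]

theorem single_mem_lieAlgebra_stabilizerGroup_iff (𝒢 : SimpleGraph (Fin m)) (i j : Fin m) :
    Matrix.single i j (1 : ℝ) ∈ lieAlgebra (stabilizerGroup 𝒢) ↔ VertexLE 𝒢 j i := by
  constructor
  · intro h
    by_cases hij : i = j
    · exact hij ▸ VertexLE.refl 𝒢 i
    obtain ⟨g, hg, hexp⟩ := h 1
    rw [exp_single_of_ne hij, one_smul] at hexp
    rw [vertexLE_iff]
    intro k hk
    by_cases hkj : k = j
    · exact Or.inl hkj
    -- In `1 + E_ij`, row `i` is nonzero at `j` and row `k` at `k`.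
    · refine Or.inr (adj_of_apply_ne_zero hg hk (Ne.symm hkj) ?_ ?_)
      · rw [hexp]
        simp [Matrix.one_apply_ne hij]
      · rw [hexp]
        simp [Ne.symm hkj]
  · intro h t
    refine ⟨(Matrix.isUnit_exp (t • Matrix.single i j (1 : ℝ))).unit,
      patternGroup_le_stabilizerGroup 𝒢 fun k l hkl => ?_, IsUnit.unit_spec _⟩
    refine exp_single_apply_eq_zero t ?_ ?_
    · rintro rfl
      exact hkl (VertexLE.refl 𝒢 k)
    · rintro ⟨rfl, rfl⟩
      exact hkl h

end GaussianGraph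

theorem mainTheorem8 (m : ℕ) (𝒢 : SimpleGraph (Fin m)) :
    (∀ i j : Fin m,
      Matrix.single i j (1 : ℝ) ∈ GaussianGraph.lieAlgebra (GaussianGraph.stabilizerGroup 𝒢) ↔
        GaussianGraph.VertexLE 𝒢 j i) ∧
    GaussianGraph.zariskiIdentityComponent (GaussianGraph.stabilizerGroup 𝒢) =
      (GaussianGraph.patternGroup 𝒢 : Set (GL (Fin m) ℝ)) :=
  ⟨GaussianGraph.single_mem_lieAlgebra_stabilizerGroup_iff 𝒢,
    GaussianGraph.zariskiIdentityComponent_stabilizerGroup 𝒢⟩
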